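/- Let $r\ge 0$, let $B\subset\mathbb R^r$ be compact, and let $\mathfrak X\subset\mathbb A^r_{\mathbb Z}=\operatorname{Spec}\mathbb Z[x_1,\dots,x_r]$ be a nonempty closed subscheme of codimension $a$. Then for every $\epsilon>0$ there is a constant $C>0$, depending only on $B$, $\mathfrak X$ and $\epsilon$, such that for every integer $m\ge 1$, every $x_0\in\mathbb Z^r$ and all real numbers $\lambda,P$ with $P>\lambda/m>1$, the set of pairs $$\{(x,p)\;:\; x\in\lambda B\cap(x_0+m\mathbb Z^r),\ p \text{ a prime in } [P,2P],\ p\nmid m,\ (x \bmod p)\in\mathfrak X(\mathbb F_p)\}$$ is finite and has at most $C\,(\lambda/m)^{r-a}\,P\,\lambda^{\epsilon}$ elements. -/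

import Mathlib

open scoped Pointwise

namespace GeometricSieve

open AlgebraicGeometry CategoryTheory

/-- Affine `r`-space `𝔸^r_ℤ = Spec ℤ[x_1, …, x_r]`. -/
noncomputable abbrev affineSpace (r : ℕ) : Scheme.{0} :=
  Spec (CommRingCat.of (MvPolynomial (Fin r) ℤ))

/-- The codimension in `𝔸^r_ℤ` of the closed subscheme given by a closed immersion
`i : X ⟶ 𝔸^r_ℤ`: the infimum, over the points `z` of `X`, of the codimension of `i z`.
Points of a scheme are ordered with `u ≤ v` when `u` lies in the closure of `v`, so the coheight
of a point is the supremum of the lengths of chains of irreducible closed subsets starting at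
its closure (equivalently, the Krull dimension of its local ring).
The empty subscheme has codimension `⊤`. -/
noncomputable def codim {r : ℕ} {X : Scheme.{0}} (i : X ⟶ affineSpace r) : ℕ∞ :=
  ⨅ z : X, Order.coheight (i z)

/-- The `𝔽_p`-point `x mod p` of `𝔸^r_ℤ` attached to `x ∈ ℤ^r`. -/
noncomputable def reductionMod {r : ℕ} (p : ℕ) (x : Fin r → ℤ) :
    Spec (CommRingCat.of (ZMod p)) ⟶ affineSpace r :=
  Spec.map (CommRingCat.ofHom
    (MvPolynomial.eval₂Hom (Int.castRingHom (ZMod p)) (fun j => (x j : ZMod p))))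

/-- `x mod p ∈ X(𝔽_p)`: the `𝔽_p`-point `x mod p` of `𝔸^r_ℤ` comes from an `𝔽_p`-point of `X`. -/
def ReductionMem {r : ℕ} {X : Scheme.{0}} (i : X ⟶ affineSpace r) (p : ℕ)
    (x : Fin r → ℤ) : Prop :=
  ∃ y : Spec (CommRingCat.of (ZMod p)) ⟶ X, y ≫ i = reductionMod p x

/-- The pairs `(x, p)` with `x ∈ lam B ∩ (x₀ + m ℤ^r)`, `p` a prime in `[P, 2P]` not dividing `m`,
and `x mod p ∈ X(𝔽_p)`. -/
def pairs {r : ℕ} {X : Scheme.{0}} (i : X ⟶ affineSpace r) (B : Set (Fin r → ℝ))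
    (lam : ℝ) (m : ℕ) (x₀ : Fin r → ℤ) (P : ℝ) : Set ((Fin r → ℤ) × ℕ) :=
  {q | (fun j => (q.1 j : ℝ)) ∈ lam • B ∧ (∃ y : Fin r → ℤ, q.1 = x₀ + (m : ℤ) • y) ∧
    q.2.Prime ∧ (q.2 : ℝ) ∈ Set.Icc P (2 * P) ∧ ¬ q.2 ∣ m ∧ ReductionMem i q.2 q.1}

end GeometricSieve

/-!
The bound holds without the factor `lam ^ ε`, which is at least `1`. A closed subscheme of
codimension `a` is the zero locus of an ideal `I` of `ℤ[x_1, …, x_n]` of height at least `a`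
(`exists_ideal_of_isClosedImmersion`), and the number of pairs `(x, p)` with `x mod p` on that locus
is `O((lam / m)^(n - a) P)` by induction on `n` (`hasSieveBound_of_le_height`).

It suffices to treat a prime `𝔭`, since evaluation at a point over `𝔽_p` has a prime kernel. Let `𝔮` be
the contraction of `𝔭` to the polynomials not involving the first variable. If `𝔮` has height at least
`a`, the bound for `𝔮` is multiplied by the number `O(lam / m)` of possible first coordinates
(`exists_ncard_tail_le`). Otherwise `𝔮` has height `a - 1` (`height_le_height_comap_C_add_one`) and
`𝔭 ≠ 𝔮[x]` (`height_map_C_of_isPrime`), so some `f ∈ 𝔭` has a coefficient `c ∉ 𝔮`. Over points of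
`V(𝔮)` where `c` is nonzero modulo `p`, the first coordinate is a root modulo `p` of a nonzero
polynomial of bounded degree; as it is also fixed modulo `m`, with `p ∤ m` and `m p > lam`, there are
`O(1)` choices (`ncard_root_fiber_le`). Points where `c` vanishes modulo `p` project to `V(𝔮 + (c))`,
which has codimension at least `a`, and are counted as in the other case (`hasSieveBound_of_coeff`).
-/

namespace GeometricSieve

/-! ### Heights of primes in a polynomial ring -/

section Heights

open Polynomial

/-- A prime of `D[X]` contracting to zero corresponds to a prime of the principal ideal domain
`Frac(D)[X]`. -/
lemma height_le_one_of_comap_C_eq_bot {D : Type*} [CommRing D] [IsDomain D] (P : Ideal D[X])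
    [P.IsPrime] (h : P.comap C = ⊥) : P.height ≤ 1 := by
  let K := FractionRing D
  let : Algebra D[X] K[X] := Polynomial.algebra D K
  have : IsLocalization ((nonZeroDivisors D).map C) K[X] := Polynomial.isLocalization _ K
  have disj : Disjoint ((nonZeroDivisors D).map C : Set D[X]) P := by
    refine Set.disjoint_left.mpr ?_
    rintro _ ⟨b, hb, rfl⟩ hP
    have : b ∈ P.comap C := hP
    rw [h, Ideal.mem_bot] at this
    exact nonZeroDivisors.ne_zero hb this
  rw [← IsLocalization.height_map_of_disjoint (S := K[X]) _ P disj]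
  have hp := IsLocalization.isPrime_of_isPrime_disjoint _ K[X] P inferInstance disj
  have := Ideal.height_le_ringKrullDim_of_isPrime (I := P.map (algebraMap D[X] K[X]))
  rw [Polynomial.ringKrullDim_of_isNoetherianRing, ringKrullDim_eq_zero_of_field, zero_add] at this
  exact_mod_cast this

variable {R : Type*} [CommRing R] [IsNoetherianRing R]

lemma height_le_height_comap_C_add_one (P : Ideal R[X]) [P.IsPrime] :
    P.height ≤ (P.comap C).height + 1 := by
  set q := P.comap C with hq
  have : q.IsPrime := Ideal.comap_isPrime _ _
  have : P.LiesOver q := ⟨rfl⟩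
  refine (Ideal.height_le_height_add_of_liesOver q P).trans ?_
  gcongr
  let e : (R ⧸ q)[X] ≃+* R[X] ⧸ q.map (C : R →+* R[X]) :=
    Ideal.polynomialQuotientEquivQuotientPolynomial q
  have hle : q.map (C : R →+* R[X]) ≤ P := Ideal.map_comap_le
  have : (P.map (Ideal.Quotient.mk (q.map (C : R →+* R[X])))).IsPrime :=
    Ideal.map_isPrime_of_surjective Ideal.Quotient.mk_surjective (by simpa using hle)
  change (P.map (Ideal.Quotient.mk (q.map (C : R →+* R[X])))).height ≤ 1
  rw [← e.height_comap]
  have := Ideal.comap_isPrime e.toRingHom (P.map (Ideal.Quotient.mk (q.map (C : R →+* R[X]))))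
  refine height_le_one_of_comap_C_eq_bot _ ?_
  refine (Submodule.eq_bot_iff _).mpr fun x hx => ?_
  obtain ⟨x, rfl⟩ := Ideal.Quotient.mk_surjective x
  have h1 : e (C (Ideal.Quotient.mk q x)) = Ideal.Quotient.mk _ (C x) := by
    have := Ideal.polynomialQuotientEquivQuotientPolynomial_map_mk q (C x)
    simpa using this
  have h2 : e (C (Ideal.Quotient.mk q x)) ∈ P.map (Ideal.Quotient.mk (q.map (C : R →+* R[X]))) := hx
  rw [h1, Ideal.mem_quotient_iff_mem hle] at h2
  exact Ideal.Quotient.eq_zero_iff_mem.mpr h2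

lemma height_map_C_of_isPrime (q : Ideal R) [q.IsPrime] :
    (q.map (C : R →+* R[X])).height = q.height := by
  have : (q.map (C : R →+* R[X])).IsPrime := Ideal.isPrime_map_C_of_isPrime
  have : (q.map (C : R →+* R[X])).LiesOver q := ⟨by
    ext x
    simp only [Ideal.under_def, Ideal.mem_comap, algebraMap_eq, Ideal.mem_map_C_iff]
    refine ⟨fun h n => ?_, fun h => by simpa using h 0⟩
    rw [coeff_C]
    split_ifs
    exacts [h, q.zero_mem]⟩
  rw [Ideal.height_eq_height_add_of_liesOver_of_hasGoingDown q (q.map (C : R →+* R[X]))]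
  simp

end Heights

/-! ### Counting integers in fibres and residue classes -/

section Counting

open Classical in
lemma ncard_le_mul_ncard_of_fibers {α β : Type*} {S : Set α} {T : Set β} (hS : S.Finite)
    (hT : T.Finite) (g : α → β) (hg : ∀ s ∈ S, g s ∈ T) {K : ℝ}
    (hK : ∀ b ∈ T, ({s ∈ S | g s = b}.ncard : ℝ) ≤ K) :
    (S.ncard : ℝ) ≤ K * T.ncard := by
  lift S to Finset α using hS
  lift T to Finset β using hT
  have hsum := Finset.card_eq_sum_card_fiberwise (f := g) (s := S) (t := T) (fun a ha => hg a ha)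
  rw [Set.ncard_coe_finset, Set.ncard_coe_finset, hsum, Nat.cast_sum, mul_comm, ← nsmul_eq_mul]
  refine Finset.sum_le_card_nsmul _ _ _ fun b hb => ?_
  have := hK b hb
  rwa [show {s ∈ (S : Set α) | g s = b} = ((S.filter (g · = b) : Finset α) : Set α) by
    ext; simp, Set.ncard_coe_finset] at this

lemma finite_setOf_abs_le (Y : ℝ) : {t : ℤ | |(t : ℝ)| ≤ Y}.Finite := by
  refine (Set.finite_Icc (-⌊Y⌋) ⌊Y⌋).subset fun t (ht : |(t : ℝ)| ≤ Y) => ?_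
  rw [abs_le] at ht
  refine ⟨?_, Int.le_floor.mpr ht.2⟩
  rw [neg_le, Int.le_floor]
  push_cast
  linarith

/-- Integers in `[-Y, Y]` that are pairwise congruent modulo `M` number at most `2Y/M + 1`. -/
lemma ncard_le_of_modEq {A : Set ℤ} {Y : ℝ} (hY : 0 ≤ Y) {M : ℕ} (hM : 0 < M)
    (hA : ∀ t ∈ A, |(t : ℝ)| ≤ Y) (hc : ∀ s ∈ A, ∀ t ∈ A, s ≡ t [ZMOD M]) :
    (A.ncard : ℝ) ≤ 2 * Y / M + 1 := by
  have hfin : A.Finite := (finite_setOf_abs_le Y).subset hA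
  have hM' : (0 : ℝ) < M := by exact_mod_cast hM
  rcases A.eq_empty_or_nonempty with rfl | hne
  · simp only [Set.ncard_empty, Nat.cast_zero]; positivity
  obtain ⟨v, hv, hmin⟩ := hfin.exists_minimalFor id A hne
  have hmin' : ∀ t ∈ A, v ≤ t := fun t ht => by
    rcases le_total v t with h | h
    · exact h
    · exact hmin ht h
  have hk : ∀ t ∈ A, ∃ k : ℕ, t = v + M * k := fun t ht => by
    obtain ⟨k, hk⟩ := (hc v hv t ht).dvd
    have h0 : 0 ≤ (M : ℤ) * k := by have := hmin' t ht; omega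
    have hk0 : 0 ≤ k := nonneg_of_mul_nonneg_right h0 (by exact_mod_cast hM)
    lift k to ℕ using hk0
    exact ⟨k, by omega⟩
  have hsub : A ⊆ (fun k : ℕ => v + (M : ℤ) * k) '' (Finset.range (⌊2 * Y / M⌋₊ + 1) : Set ℕ) := by
    intro t ht
    obtain ⟨k, hkt⟩ := hk t ht
    refine ⟨k, ?_, hkt.symm⟩
    rw [Finset.mem_coe, Finset.mem_range, Nat.lt_succ_iff]
    refine Nat.le_floor ?_
    rw [le_div_iff₀ hM']
    have h1 := (abs_le.mp (hA t ht)).2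
    have h2 := (abs_le.mp (hA v hv)).1
    rw [hkt] at h1
    push_cast at h1
    linarith
  have h1 : A.ncard ≤ ⌊2 * Y / M⌋₊ + 1 :=
    (Set.ncard_le_ncard hsub ((Finset.finite_toSet _).image _)).trans
      ((Set.ncard_image_le (Finset.finite_toSet _)).trans (by
        rw [Set.ncard_coe_finset, Finset.card_range]))
  calc (A.ncard : ℝ) ≤ (⌊2 * Y / M⌋₊ : ℝ) + 1 := by exact_mod_cast h1
    _ ≤ _ := by gcongr; exact Nat.floor_le (by positivity)

end Counting

/-! ### The counting bound for ideals -/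

section Pairs

variable {n : ℕ}

/-- Evaluation of integral polynomials at the reduction of `x ∈ ℤ^n` modulo `p`. -/
noncomputable def evalMod (p : ℕ) (x : Fin n → ℤ) : MvPolynomial (Fin n) ℤ →+* ZMod p :=
  MvPolynomial.eval₂Hom (Int.castRingHom (ZMod p)) (fun j => (x j : ZMod p))

/-- The pairs `(x, p)` with `x` in the box `[-R lam, R lam]^n`, `x ≡ x₀ mod m`, and `p ∤ m` a prime
in `[P, 2P]`. -/
def boxPairs (R lam : ℝ) (m : ℕ) (x₀ : Fin n → ℤ) (P : ℝ) : Set ((Fin n → ℤ) × ℕ) :=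
  {q | (∀ j, |(q.1 j : ℝ)| ≤ R * lam) ∧ (∀ j, q.1 j ≡ x₀ j [ZMOD m]) ∧
    q.2.Prime ∧ P ≤ q.2 ∧ (q.2 : ℝ) ≤ 2 * P ∧ ¬ q.2 ∣ m}

/-- The pairs `(x, p)` of `boxPairs` such that `x mod p` lies on the zero locus of the ideal `I`. -/
def zeroPairs (I : Ideal (MvPolynomial (Fin n) ℤ)) (R lam : ℝ) (m : ℕ) (x₀ : Fin n → ℤ) (P : ℝ) :
    Set ((Fin n → ℤ) × ℕ) :=
  {q ∈ boxPairs R lam m x₀ P | I ≤ RingHom.ker (evalMod q.2 q.1)}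

/-- The counting bound expected when the zero locus of `I` has codimension `a` in `𝔸^n_ℤ`: at most
`C (lam / m)^(n - a) P` pairs, with `C` depending only on `I`, `a` and the size `R` of the box. -/
def HasSieveBound (I : Ideal (MvPolynomial (Fin n) ℤ)) (a : ℕ) : Prop :=
  ∀ R : ℝ, 0 ≤ R → ∃ C : ℝ, 0 < C ∧ ∀ (lam : ℝ) (m : ℕ) (x₀ : Fin n → ℤ) (P : ℝ),
    1 ≤ m → 1 < lam / m → lam / m < P →
      ((zeroPairs I R lam m x₀ P).ncard : ℝ) ≤ C * ((lam / m) ^ ((n : ℤ) - (a : ℤ)) * P)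

lemma finite_boxPairs (R lam : ℝ) (m : ℕ) (x₀ : Fin n → ℤ) (P : ℝ) :
    (boxPairs R lam m x₀ P).Finite := by
  refine ((Set.Finite.pi' fun _ => finite_setOf_abs_le (R * lam)).prod
    (Set.finite_le_nat ⌊2 * P⌋₊)).subset ?_
  rintro ⟨x, p⟩ ⟨h1, -, -, -, h2, -⟩
  exact ⟨h1, Nat.le_floor h2⟩

lemma finite_zeroPairs (I : Ideal (MvPolynomial (Fin n) ℤ)) (R lam : ℝ) (m : ℕ) (x₀ : Fin n → ℤ)
    (P : ℝ) : (zeroPairs I R lam m x₀ P).Finite :=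
  (finite_boxPairs R lam m x₀ P).subset fun _ h => h.1

/-- The kernel of evaluation at a point over `𝔽_p` is prime, so it contains `I` exactly when it
contains one of the finitely many minimal primes of `I`. -/
lemma hasSieveBound_of_minimalPrimes {I : Ideal (MvPolynomial (Fin n) ℤ)} {a : ℕ}
    (h : ∀ 𝔭 ∈ I.minimalPrimes, HasSieveBound 𝔭 a) : HasSieveBound I a := by
  intro R hR
  have hfin : I.minimalPrimes.Finite := I.finite_minimalPrimes_of_isNoetherianRing _
  choose! C hC hbound using fun 𝔭 h𝔭 => h 𝔭 h𝔭 R hR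
  have hsum : 0 ≤ ∑ 𝔭 ∈ hfin.toFinset, C 𝔭 :=
    Finset.sum_nonneg fun 𝔭 h𝔭 => (hC 𝔭 (by simpa using h𝔭)).le
  refine ⟨∑ 𝔭 ∈ hfin.toFinset, C 𝔭 + 1, by linarith, fun lam m x₀ P hm hL hP => ?_⟩
  have hpos : 0 ≤ (lam / m) ^ ((n : ℤ) - (a : ℤ)) * P := by
    have : 0 < lam / m := by linarith
    have : 0 < P := by linarith
    positivity
  have hsub : zeroPairs I R lam m x₀ P ⊆
      ⋃ 𝔭 ∈ hfin.toFinset, zeroPairs 𝔭 R lam m x₀ P := by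
    rintro ⟨x, p⟩ ⟨hq, hI⟩
    have : Fact p.Prime := ⟨hq.2.2.1⟩
    have : (RingHom.ker (evalMod p x)).IsPrime := RingHom.ker_isPrime _
    obtain ⟨𝔭, h𝔭, hle⟩ := Ideal.exists_minimalPrimes_le hI
    simp only [Set.mem_iUnion]
    exact ⟨𝔭, by simpa using h𝔭, hq, hle⟩
  calc ((zeroPairs I R lam m x₀ P).ncard : ℝ)
      ≤ ((⋃ 𝔭 ∈ hfin.toFinset, zeroPairs 𝔭 R lam m x₀ P).ncard : ℝ) := by
        exact_mod_cast Set.ncard_le_ncard hsub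
          (Set.Finite.biUnion (Finset.finite_toSet _) fun _ _ => finite_zeroPairs ..)
    _ ≤ ∑ 𝔭 ∈ hfin.toFinset, ((zeroPairs 𝔭 R lam m x₀ P).ncard : ℝ) := by
        exact_mod_cast Finset.set_ncard_biUnion_le _ _
    _ ≤ ∑ 𝔭 ∈ hfin.toFinset, C 𝔭 * ((lam / m) ^ ((n : ℤ) - (a : ℤ)) * P) :=
        Finset.sum_le_sum fun 𝔭 h𝔭 => hbound 𝔭 (by simpa using h𝔭) lam m x₀ P hm hL hP
    _ ≤ _ := by rw [← Finset.sum_mul]; nlinarith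

/-- The projection forgetting the first coordinate of the point. -/
def tailPair (q : (Fin (n + 1) → ℤ) × ℕ) : (Fin n → ℤ) × ℕ := (Fin.tail q.1, q.2)

lemma tailPair_mem_boxPairs {R lam : ℝ} {m : ℕ} {x₀ : Fin (n + 1) → ℤ} {P : ℝ}
    {q : (Fin (n + 1) → ℤ) × ℕ} (hq : q ∈ boxPairs R lam m x₀ P) :
    tailPair q ∈ boxPairs R lam m (Fin.tail x₀) P :=
  ⟨fun j => hq.1 j.succ, fun j => hq.2.1 j.succ, hq.2.2⟩

/-- A set of pairs with fixed tail is counted by the first coordinates of its points. -/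
lemma ncard_image_head {S : Set ((Fin (n + 1) → ℤ) × ℕ)} {b : (Fin n → ℤ) × ℕ}
    (hS : ∀ q ∈ S, tailPair q = b) : ((fun q => q.1 0) '' S).ncard = S.ncard := by
  refine Set.InjOn.ncard_image ?_
  rintro ⟨x, p⟩ hx ⟨y, p'⟩ hy (hxy : x 0 = y 0)
  have h := (hS _ hx).trans (hS _ hy).symm
  simp only [tailPair, Prod.mk.injEq] at h
  refine Prod.ext ?_ h.2
  rw [← Fin.cons_self_tail x, ← Fin.cons_self_tail y, hxy, h.1]

lemma ncard_fiber_le {R lam : ℝ} (hR : 0 ≤ R) {m : ℕ} {x₀ : Fin (n + 1) → ℤ} {P : ℝ}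
    (hm : 1 ≤ m) (hL : 1 < lam / m) {S : Set ((Fin (n + 1) → ℤ) × ℕ)}
    (hS : S ⊆ boxPairs R lam m x₀ P) (b : (Fin n → ℤ) × ℕ) :
    ({q ∈ S | tailPair q = b}.ncard : ℝ) ≤ (2 * R + 1) * (lam / m) := by
  have hm' : (0 : ℝ) < m := by exact_mod_cast hm
  have hlam : 0 < lam := by
    rw [lt_div_iff₀ hm'] at hL; linarith
  rw [← ncard_image_head (b := b) fun q hq => hq.2]
  have := ncard_le_of_modEq (A := (fun q => q.1 0) '' {q ∈ S | tailPair q = b}) (Y := R * lam)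
    (by positivity) (M := m) hm
    (by rintro _ ⟨q, hq, rfl⟩; exact (hS hq.1).1 0)
    (by
      rintro _ ⟨q, hq, rfl⟩ _ ⟨q', hq', rfl⟩
      exact ((hS hq.1).2.1 0).trans ((hS hq'.1).2.1 0).symm)
  refine this.trans ?_
  rw [mul_div_assoc, mul_div_assoc]
  nlinarith

/-- The pairs lying over the zero locus of `J` under the projection `𝔸^{n+1} → 𝔸^n` satisfy the bound
with the same `a`: each fibre has `O(lam / m)` points, since `lam / m > 1`. -/
lemma exists_ncard_tail_le {J : Ideal (MvPolynomial (Fin n) ℤ)} {a : ℕ} (hJ : HasSieveBound J a)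
    {R : ℝ} (hR : 0 ≤ R) :
    ∃ C : ℝ, 0 < C ∧ ∀ (lam : ℝ) (m : ℕ) (x₀ : Fin (n + 1) → ℤ) (P : ℝ),
      1 ≤ m → 1 < lam / m → lam / m < P →
      ({q ∈ boxPairs R lam m x₀ P | J ≤ RingHom.ker (evalMod q.2 (Fin.tail q.1))}.ncard : ℝ) ≤
        C * ((lam / m) ^ (((n + 1 : ℕ) : ℤ) - (a : ℤ)) * P) := by
  obtain ⟨C, hC, h⟩ := hJ R hR
  refine ⟨(2 * R + 1) * C, by positivity, fun lam m x₀ P hm hL hP => ?_⟩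
  have hL0 : lam / m ≠ 0 := by linarith
  have hfin := (finite_boxPairs R lam m x₀ P).subset
    (Set.sep_subset _ fun q => J ≤ RingHom.ker (evalMod q.2 (Fin.tail q.1)))
  refine (ncard_le_mul_ncard_of_fibers hfin (finite_zeroPairs J R lam m (Fin.tail x₀) P) tailPair
    (fun q hq => ⟨tailPair_mem_boxPairs hq.1, hq.2⟩)
    fun b _ => ncard_fiber_le hR hm hL (Set.sep_subset _ _) b).trans ?_
  refine (mul_le_mul_of_nonneg_left (h lam m (Fin.tail x₀) P hm hL hP) (by
    have : 0 < lam / m := by linarith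
    positivity)).trans_eq ?_
  rw [show ((n + 1 : ℕ) : ℤ) - (a : ℤ) = ((n : ℤ) - a) + 1 by push_cast; ring, zpow_add_one₀ hL0]
  ring

lemma evalMod_eq_eval_map (p : ℕ) (x : Fin (n + 1) → ℤ) (f : MvPolynomial (Fin (n + 1)) ℤ) :
    evalMod p x f = Polynomial.eval (x 0 : ZMod p)
      (Polynomial.map (evalMod p (Fin.tail x)) (MvPolynomial.finSuccEquiv ℤ n f)) := by
  rw [Polynomial.eval_map]
  have : evalMod p x = (Polynomial.eval₂RingHom (evalMod p (Fin.tail x)) (x 0 : ZMod p)).comp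
      (MvPolynomial.finSuccEquiv ℤ n : _ →+* _) := by
    refine MvPolynomial.ringHom_ext (fun k => by simp) fun j => ?_
    refine Fin.cases ?_ (fun j => ?_) j
    · simp [evalMod, MvPolynomial.finSuccEquiv_X_zero]
    · simp [evalMod, MvPolynomial.finSuccEquiv_X_succ, Fin.tail]
  rw [this]
  rfl

/-- For a fixed tail and `p`, the first coordinate is a root modulo `p` of the nonzero
polynomial that `f` induces in that coordinate; since `m p` exceeds `lam`, each root has `O(1)`
lifts in the box that are congruent to `x₀` modulo `m`. -/
lemma ncard_root_fiber_le {R lam : ℝ} (hR : 0 ≤ R) {m : ℕ} {x₀ : Fin (n + 1) → ℤ} {P : ℝ}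
    (hm : 1 ≤ m) (hL : 1 < lam / m) (hP : lam / m < P) {S : Set ((Fin (n + 1) → ℤ) × ℕ)}
    (hS : S ⊆ boxPairs R lam m x₀ P) (f : MvPolynomial (Fin (n + 1)) ℤ)
    (hroot : ∀ q ∈ S, evalMod q.2 q.1 f = 0)
    (hne : ∀ q ∈ S,
      Polynomial.map (evalMod q.2 (Fin.tail q.1)) (MvPolynomial.finSuccEquiv ℤ n f) ≠ 0)
    (b : (Fin n → ℤ) × ℕ) :
    ({q ∈ S | tailPair q = b}.ncard : ℝ) ≤
      (2 * R + 1) * (MvPolynomial.finSuccEquiv ℤ n f).natDegree := by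
  have hm' : (0 : ℝ) < m := by exact_mod_cast hm
  obtain ⟨x', p⟩ := b
  rcases {q ∈ S | tailPair q = (x', p)}.eq_empty_or_nonempty with h0 | ⟨⟨y, p'⟩, hy, hyb⟩
  · rw [h0, Set.ncard_empty, Nat.cast_zero]; positivity
  obtain ⟨rfl, rfl⟩ : Fin.tail y = x' ∧ p' = p := by simpa [tailPair] using hyb
  obtain ⟨-, -, hp, hPp, -, hpm⟩ := hS hy
  have : Fact p'.Prime := ⟨hp⟩
  set F := Polynomial.map (evalMod p' (Fin.tail y)) (MvPolynomial.finSuccEquiv ℤ n f) with hF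
  have hF0 : F ≠ 0 := hne _ hy
  have htail : ∀ q ∈ {q ∈ S | tailPair q = (Fin.tail y, p')},
      Fin.tail q.1 = Fin.tail y ∧ q.2 = p' := fun q hq => by simpa [tailPair] using hq.2
  have hlam : lam ≤ ((m * p' : ℕ) : ℝ) := by
    rw [div_lt_iff₀ hm'] at hP
    push_cast
    nlinarith
  have hp0 : (0 : ℝ) < ((m * p' : ℕ) : ℝ) := by
    exact_mod_cast Nat.mul_pos hm hp.pos
  have hlam0 : 0 < lam := by
    rw [lt_div_iff₀ hm'] at hL; linarith
  have hroots : ((F.roots.toFinset : Set (ZMod p')).ncard : ℝ) ≤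
      (MvPolynomial.finSuccEquiv ℤ n f).natDegree := by
    rw [Set.ncard_coe_finset]
    exact_mod_cast (Multiset.toFinset_card_le _).trans
      ((Polynomial.card_roots' F).trans Polynomial.natDegree_map_le)
  refine (ncard_le_mul_ncard_of_fibers (K := 2 * R + 1) (T := (F.roots.toFinset : Set (ZMod p')))
    ((finite_boxPairs R lam m x₀ P).subset ((Set.sep_subset _ _).trans hS))
    (Finset.finite_toSet _) (fun q => (q.1 0 : ZMod p')) ?_ ?_).trans
    (mul_le_mul_of_nonneg_left hroots (by positivity))
  · rintro ⟨x, p⟩ hq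
    obtain ⟨hx, rfl⟩ := htail _ hq
    have h := hroot _ hq.1
    rw [evalMod_eq_eval_map] at h
    simp only [Finset.mem_coe, Multiset.mem_toFinset, Polynomial.mem_roots hF0]
    simp only at hx
    rwa [Polynomial.IsRoot.def, hF, ← hx]
  · intro ρ _
    rw [← ncard_image_head (b := (Fin.tail y, p')) fun q hq => hq.1.2]
    have hcop : IsCoprime (m : ℤ) (p' : ℤ) :=
      Nat.isCoprime_iff_coprime.mpr ((hp.coprime_iff_not_dvd.mpr hpm).symm)
    refine (ncard_le_of_modEq (Y := R * lam) (by positivity) (M := m * p')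
      (Nat.mul_pos hm hp.pos) ?_ ?_).trans ?_
    · rintro _ ⟨q, hq, rfl⟩
      exact (hS hq.1.1).1 0
    · rintro _ ⟨q, hq, rfl⟩ _ ⟨q', hq', rfl⟩
      have h1 := ((hS hq.1.1).2.1 0).trans ((hS hq'.1.1).2.1 0).symm
      have h2 : q.1 0 ≡ q'.1 0 [ZMOD p'] :=
        (ZMod.intCast_eq_intCast_iff _ _ _).mp (hq.2.trans hq'.2.symm)
      push_cast
      exact Int.modEq_iff_dvd.mpr (hcop.mul_dvd h1.dvd h2.dvd)
    · have : 2 * (R * lam) / ((m * p' : ℕ) : ℝ) ≤ 2 * R := by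
        rw [div_le_iff₀ hp0]
        nlinarith
      linarith

/-- A point on the zero locus of `I` projects to the zero locus of any ideal contracted from `I`. -/
lemma ker_tail_of_ker {I : Ideal (MvPolynomial (Fin (n + 1)) ℤ)}
    {J : Ideal (MvPolynomial (Fin n) ℤ)}
    (hJI : ∀ g ∈ J, (MvPolynomial.finSuccEquiv ℤ n).symm (Polynomial.C g) ∈ I)
    {p : ℕ} {x : Fin (n + 1) → ℤ} (h : I ≤ RingHom.ker (evalMod p x)) :
    J ≤ RingHom.ker (evalMod p (Fin.tail x)) := by
  intro g hg
  have hg' : evalMod p x ((MvPolynomial.finSuccEquiv ℤ n).symm (Polynomial.C g)) = 0 :=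
    h (hJI g hg)
  rw [evalMod_eq_eval_map, AlgEquiv.apply_symm_apply] at hg'
  simpa using hg'

/-- Let `c` be any coefficient of `f ∈ I` as a polynomial in the first coordinate. Over the points of
`V(J)` where `c` does not vanish modulo `p`, the polynomial induced by `f` is nonzero and leaves
`O(1)` points in each fibre; the remaining points have tail on `V(J + (c))`. -/
lemma hasSieveBound_of_coeff {I : Ideal (MvPolynomial (Fin (n + 1)) ℤ)}
    {J : Ideal (MvPolynomial (Fin n) ℤ)} {a : ℕ}
    (hJI : ∀ g ∈ J, (MvPolynomial.finSuccEquiv ℤ n).symm (Polynomial.C g) ∈ I)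
    {f : MvPolynomial (Fin (n + 1)) ℤ} (hf : f ∈ I) {k : ℕ} (hJ : HasSieveBound J a)
    (hJc : HasSieveBound
      (J ⊔ Ideal.span {(MvPolynomial.finSuccEquiv ℤ n f).coeff k}) (a + 1)) :
    HasSieveBound I (a + 1) := by
  intro R hR
  set c := (MvPolynomial.finSuccEquiv ℤ n f).coeff k with hc
  obtain ⟨C₁, hC₁, h₁⟩ := hJ R hR
  obtain ⟨C₂, hC₂, h₂⟩ := exists_ncard_tail_le hJc hR
  set d := (MvPolynomial.finSuccEquiv ℤ n f).natDegree
  refine ⟨(2 * R + 1) * d * C₁ + C₂, by positivity, fun lam m x₀ P hm hL hP => ?_⟩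
  set S := {q ∈ zeroPairs I R lam m x₀ P |
    Polynomial.map (evalMod q.2 (Fin.tail q.1)) (MvPolynomial.finSuccEquiv ℤ n f) ≠ 0}
  set S' := {q ∈ boxPairs R lam m x₀ P | J ⊔ Ideal.span {c} ≤
    RingHom.ker (evalMod q.2 (Fin.tail q.1))}
  have hS : S ⊆ boxPairs R lam m x₀ P := fun q hq => hq.1.1
  have hsub : zeroPairs I R lam m x₀ P ⊆ S ∪ S' := by
    intro q hq
    by_cases h : Polynomial.map (evalMod q.2 (Fin.tail q.1)) (MvPolynomial.finSuccEquiv ℤ n f) = 0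
    · refine Or.inr ⟨hq.1, sup_le (ker_tail_of_ker hJI hq.2) ?_⟩
      rw [Ideal.span_singleton_le_iff_mem, RingHom.mem_ker, hc, ← Polynomial.coeff_map, h,
        Polynomial.coeff_zero]
    · exact Or.inl ⟨hq, h⟩
  have hSle : (S.ncard : ℝ) ≤ (2 * R + 1) * d * (zeroPairs J R lam m (Fin.tail x₀) P).ncard :=
    ncard_le_mul_ncard_of_fibers ((finite_boxPairs R lam m x₀ P).subset hS)
      (finite_zeroPairs J R lam m (Fin.tail x₀) P) tailPair
      (fun q hq => ⟨tailPair_mem_boxPairs hq.1.1, ker_tail_of_ker hJI hq.1.2⟩)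
      fun b _ => ncard_root_fiber_le hR hm hL hP hS f (fun q hq => hq.1.2 hf) (fun q hq => hq.2) b
  have hfin := (finite_boxPairs R lam m x₀ P).subset hS
  have hfin' : S'.Finite := (finite_boxPairs R lam m x₀ P).subset (Set.sep_subset _ _)
  have hexp : ((n + 1 : ℕ) : ℤ) - ((a + 1 : ℕ) : ℤ) = (n : ℤ) - a := by push_cast; ring
  have h₁' := h₁ lam m (Fin.tail x₀) P hm hL hP
  have h₂' := h₂ lam m x₀ P hm hL hP
  rw [hexp] at h₂' ⊢
  calc ((zeroPairs I R lam m x₀ P).ncard : ℝ) ≤ ((S ∪ S').ncard : ℝ) := by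
        exact_mod_cast Set.ncard_le_ncard hsub (hfin.union hfin')
    _ ≤ S.ncard + S'.ncard := by exact_mod_cast Set.ncard_union_le S S'
    _ ≤ (2 * R + 1) * d * (C₁ * ((lam / m) ^ ((n : ℤ) - (a : ℤ)) * P)) +
        C₂ * ((lam / m) ^ ((n : ℤ) - (a : ℤ)) * P) :=
        add_le_add (hSle.trans (mul_le_mul_of_nonneg_left h₁' (by positivity))) h₂'
    _ = _ := by ring

/-- In zero variables a pair is just a prime. There are at most `2P` of them, and only `O(1)` if `I`
contains a nonzero integer; in that case `a ≤ 1`, so the bound `(lam / m)^(-a) P` is at least `1`. -/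
lemma hasSieveBound_zero {I : Ideal (MvPolynomial (Fin 0) ℤ)} [I.IsPrime] {a : ℕ}
    (ha : (a : ℕ∞) ≤ I.height) : HasSieveBound I a := by
  intro R hR
  have hsnd : ∀ (lam : ℝ) (m : ℕ) (x₀ : Fin 0 → ℤ) (P : ℝ),
      (Prod.snd '' zeroPairs I R lam m x₀ P).ncard = (zeroPairs I R lam m x₀ P).ncard :=
    fun lam m x₀ P => Set.InjOn.ncard_image fun q _ q' _ h => Prod.ext (Subsingleton.elim _ _) h
  by_cases hI : I = ⊥
  · obtain rfl : a = 0 := by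
      rw [hI, Ideal.height_bot] at ha
      exact_mod_cast nonpos_iff_eq_zero.mp ha
    refine ⟨2, by norm_num, fun lam m x₀ P hm hL hP => ?_⟩
    have hsub : Prod.snd '' zeroPairs I R lam m x₀ P ⊆ (Finset.Icc 1 ⌊2 * P⌋₊ : Set ℕ) := by
      rintro _ ⟨q, hq, rfl⟩
      rw [Finset.mem_coe, Finset.mem_Icc]
      exact ⟨hq.1.2.2.1.one_le, Nat.le_floor hq.1.2.2.2.2.1⟩
    have h := Set.ncard_le_ncard hsub (Finset.finite_toSet _)
    rw [hsnd, Set.ncard_coe_finset, Nat.card_Icc, Nat.add_sub_cancel] at h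
    have h' : ((zeroPairs I R lam m x₀ P).ncard : ℝ) ≤ ⌊2 * P⌋₊ := by exact_mod_cast h
    have := Nat.floor_le (show 0 ≤ 2 * P by linarith)
    simp only [Nat.cast_zero, sub_self, zpow_zero, one_mul]
    linarith
  · obtain ⟨f, hf, hf0⟩ := Submodule.exists_mem_ne_zero_of_ne_bot hI
    obtain ⟨N, rfl⟩ := MvPolynomial.C_surjective (Fin 0) f
    have hN : N ≠ 0 := by rintro rfl; simp at hf0
    have ha1 : a ≤ 1 := by
      have h := Ideal.height_le_ringKrullDim_of_isPrime (I := I)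
      rw [MvPolynomial.ringKrullDim_of_isNoetherianRing] at h
      rw [IsPrincipalIdealRing.ringKrullDim_eq_one ℤ Int.not_isField, Nat.card_of_isEmpty] at h
      have h1 : I.height ≤ 1 := by exact_mod_cast h
      exact_mod_cast ha.trans h1
    refine ⟨N.natAbs.divisors.card + 1, by positivity, fun lam m x₀ P hm hL hP => ?_⟩
    have hsub : Prod.snd '' zeroPairs I R lam m x₀ P ⊆ (N.natAbs.divisors : Set ℕ) := by
      rintro _ ⟨q, hq, rfl⟩
      have h : evalMod q.2 q.1 (MvPolynomial.C N) = 0 := hq.2 hf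
      rw [evalMod, MvPolynomial.eval₂Hom_C, eq_intCast, ZMod.intCast_zmod_eq_zero_iff_dvd] at h
      rw [Finset.mem_coe, Nat.mem_divisors]
      exact ⟨Int.natCast_dvd.mp h, by simpa using hN⟩
    have h := Set.ncard_le_ncard hsub (Finset.finite_toSet _)
    rw [hsnd, Set.ncard_coe_finset] at h
    have h' : ((zeroPairs I R lam m x₀ P).ncard : ℝ) ≤ N.natAbs.divisors.card := by exact_mod_cast h
    have hone : 1 ≤ (lam / m) ^ (((0 : ℕ) : ℤ) - (a : ℤ)) * P := by
      have hL0 : 0 < lam / m := by linarith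
      calc (1 : ℝ) = (lam / m) ^ (-1 : ℤ) * (lam / m) := by
            rw [zpow_neg_one, inv_mul_cancel₀ hL0.ne']
        _ ≤ _ := by
          gcongr
          · exact hL.le
          · push_cast; omega
    nlinarith [(Nat.cast_nonneg N.natAbs.divisors.card : (0 : ℝ) ≤ _)]

/-- The counting bound for ideals of height at least `a`. In the induction step a minimal prime `𝔭`
is compared with its contraction `𝔮` to the last `n` variables: if `𝔮` has height less than `a`,
then `𝔭` is not extended from `𝔮`, and any `F ∈ 𝔭` outside the extension has a coefficient outside
`𝔮`, which raises the height when added to `𝔮`. -/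
theorem hasSieveBound_of_le_height (I : Ideal (MvPolynomial (Fin n) ℤ)) {a : ℕ}
    (ha : (a : ℕ∞) ≤ I.height) : HasSieveBound I a := by
  induction n generalizing a with
  | zero =>
    refine hasSieveBound_of_minimalPrimes fun 𝔭 h𝔭 => ?_
    have := h𝔭.isPrime
    exact hasSieveBound_zero (ha.trans (Ideal.height_mono h𝔭.le))
  | succ n ih =>
    refine hasSieveBound_of_minimalPrimes fun 𝔭 h𝔭 => ?_
    have := h𝔭.isPrime
    replace ha := ha.trans (Ideal.height_mono h𝔭.le)
    let e := (MvPolynomial.finSuccEquiv ℤ n).toRingEquiv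
    set 𝔓 := 𝔭.comap e.symm
    have : 𝔓.IsPrime := Ideal.comap_isPrime _ _
    have h𝔓ht : 𝔓.height = 𝔭.height := e.symm.height_comap 𝔭
    set 𝔮 := 𝔓.comap Polynomial.C
    have : 𝔮.IsPrime := Ideal.comap_isPrime _ _
    have h𝔮𝔭 : ∀ g ∈ 𝔮, (MvPolynomial.finSuccEquiv ℤ n).symm (Polynomial.C g) ∈ 𝔭 := fun g hg => hg
    by_cases hle : (a : ℕ∞) ≤ 𝔮.height
    · intro R hR
      obtain ⟨C, hC, h⟩ := exists_ncard_tail_le (ih 𝔮 hle) hR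
      refine ⟨C, hC, fun lam m x₀ P hm hL hP => le_trans ?_ (h lam m x₀ P hm hL hP)⟩
      have hsub : zeroPairs 𝔭 R lam m x₀ P ⊆
          {q ∈ boxPairs R lam m x₀ P | 𝔮 ≤ RingHom.ker (evalMod q.2 (Fin.tail q.1))} :=
        fun q hq => ⟨hq.1, ker_tail_of_ker h𝔮𝔭 hq.2⟩
      exact_mod_cast Set.ncard_le_ncard hsub
        ((finite_boxPairs R lam m x₀ P).subset (Set.sep_subset _ _))
    · obtain _ | a := a
      · simp at hle
      have ha𝔮 : (a : ℕ∞) ≤ 𝔮.height := by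
        have h := ha.trans (h𝔓ht ▸ height_le_height_comap_C_add_one 𝔓)
        push_cast at h
        exact (ENat.add_le_add_iff_right ENat.one_ne_top).mp h
      have hne : ¬ 𝔓 ≤ 𝔮.map Polynomial.C := fun h => hle <| by
        rw [← height_map_C_of_isPrime 𝔮]
        exact ha.trans (h𝔓ht ▸ Ideal.height_mono h)
      obtain ⟨F, hF, hF𝔮⟩ := SetLike.not_le_iff_exists.mp hne
      rw [Ideal.mem_map_C_iff, not_forall] at hF𝔮
      obtain ⟨k, hk⟩ := hF𝔮
      have hFe : MvPolynomial.finSuccEquiv ℤ n ((MvPolynomial.finSuccEquiv ℤ n).symm F) = F :=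
        AlgEquiv.apply_symm_apply _ _
      refine hasSieveBound_of_coeff h𝔮𝔭 (f := (MvPolynomial.finSuccEquiv ℤ n).symm F) hF (k := k)
        (ih 𝔮 ha𝔮) (ih _ ?_)
      rw [hFe]
      have hlt : 𝔮 < 𝔮 ⊔ Ideal.span {F.coeff k} :=
        left_lt_sup.mpr fun h => hk (h (Ideal.mem_span_singleton_self _))
      push_cast
      exact (add_le_add_left ha𝔮 1).trans
        (Order.add_one_le_of_lt (Ideal.height_strict_mono_of_isPrime hlt))

end Pairs

/-! ### From closed subschemes to ideals -/

section Scheme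

open AlgebraicGeometry CategoryTheory

/-- The closed subscheme is, as a set, the zero locus of an ideal; each prime over this ideal is a
point of the subscheme. -/
lemma exists_ideal_of_isClosedImmersion {r : ℕ} {X : Scheme.{0}} (i : X ⟶ affineSpace r)
    [IsClosedImmersion i] : ∃ I : Ideal (MvPolynomial (Fin r) ℤ), codim i ≤ I.height ∧
      ∀ (p : ℕ) (x : Fin r → ℤ), p.Prime → ReductionMem i p x → I ≤ RingHom.ker (evalMod p x) := by
  obtain ⟨I, hI⟩ := (PrimeSpectrum.isClosed_iff_zeroLocus_ideal _).mp
    i.isClosedEmbedding.isClosed_range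
  refine ⟨I, ?_, ?_⟩
  · rw [Ideal.height_eq_inf_minimalPrimes]
    refine le_iInf₂ fun 𝔭 h𝔭 => ?_
    have hz : (⟨𝔭, h𝔭.isPrime⟩ : PrimeSpectrum (MvPolynomial (Fin r) ℤ)) ∈ Set.range i := by
      rw [hI]; exact h𝔭.le
    obtain ⟨z, hz⟩ := hz
    have h := idealHeight_eq_coheight (CommRingCat.of (MvPolynomial (Fin r) ℤ)) (i z)
    refine (iInf_le _ z).trans (h.symm.trans_le ?_)
    rw [hz]
  · rintro p x hp ⟨y, hy⟩
    have : Fact p.Prime := ⟨hp⟩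
    -- The point of `Spec 𝔽_p` maps to the kernel of `evalMod p x`.
    let pt : PrimeSpectrum (ZMod p) := ⟨⊥, Ideal.isPrime_bot⟩
    have hmem : reductionMod p x pt ∈ Set.range i := ⟨y pt, by rw [← hy]; rfl⟩
    rw [hI] at hmem
    intro f hf
    have : evalMod p x f ∈ (⊥ : Ideal (ZMod p)) := hmem hf
    simpa using this

end Scheme

end GeometricSieve

open GeometricSieve in
theorem theorem7p1 (r : ℕ) (B : Set (Fin r → ℝ)) (hB : IsCompact B)
    (X : AlgebraicGeometry.Scheme.{0}) (i : X ⟶ GeometricSieve.affineSpace r)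
    [AlgebraicGeometry.IsClosedImmersion i]
    (a : ℕ) (ha : GeometricSieve.codim i = a) (ε : ℝ) (hε : 0 < ε) :
    ∃ C : ℝ, 0 < C ∧ ∀ (lam : ℝ) (m : ℕ) (x₀ : Fin r → ℤ) (P : ℝ),
      1 ≤ m → 1 < lam / m → lam / m < P →
      (GeometricSieve.pairs i B lam m x₀ P).Finite ∧
      ((GeometricSieve.pairs i B lam m x₀ P).ncard : ℝ) ≤
        C * ((lam / m) ^ ((r : ℤ) - (a : ℤ)) * P * lam ^ ε) := by
  obtain ⟨I, hcodim, hker⟩ := exists_ideal_of_isClosedImmersion i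
  obtain ⟨R, hR0, hR⟩ := hB.isBounded.exists_pos_norm_le
  obtain ⟨C, hC, hbound⟩ := hasSieveBound_of_le_height I (ha ▸ hcodim) R hR0.le
  refine ⟨C, hC, fun lam m x₀ P hm hL hP => ?_⟩
  have hm' : (1 : ℝ) ≤ m := by exact_mod_cast hm
  have hlam : 1 ≤ lam := by
    rw [lt_div_iff₀ (by linarith)] at hL; linarith
  have hsub : pairs i B lam m x₀ P ⊆ zeroPairs I R lam m x₀ P := by
    rintro ⟨x, p⟩ ⟨⟨b, hb, hbx⟩, ⟨y, hy⟩, hp, hpP, hpm, hmem⟩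
    refine ⟨⟨fun j => ?_, fun j => ?_, hp, hpP.1, hpP.2, hpm⟩, hker p x hp hmem⟩
    · have h1 : (x j : ℝ) = lam * b j := (congrFun hbx j).symm
      have h2 : |b j| ≤ R := (norm_le_pi_norm b j).trans (hR b hb)
      rw [h1, abs_mul, abs_of_pos (by linarith)]
      nlinarith
    · simp only at hy
      rw [hy]
      simp
  have hfin := finite_zeroPairs I R lam m x₀ P
  refine ⟨hfin.subset hsub, ?_⟩
  have h1 : ((pairs i B lam m x₀ P).ncard : ℝ) ≤ (zeroPairs I R lam m x₀ P).ncard := by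
    exact_mod_cast Set.ncard_le_ncard hsub hfin
  refine h1.trans ((hbound lam m x₀ P hm hL hP).trans ?_)
  have hpos : 0 ≤ (lam / m) ^ ((r : ℤ) - (a : ℤ)) * P := by
    have : 0 < lam / m := by linarith
    have : 0 < P := by linarith
    positivity
  exact mul_le_mul_of_nonneg_left
    (le_mul_of_one_le_right hpos (Real.one_le_rpow hlam hε.le)) hC.le
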